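/- For $T\ge 0$ let $c_{\rm ww}(k)=\sqrt{(1+Tk^2)\tanh(k)/k}$ for $k\neq 0$ and $c_{\rm ww}(0)=1$, and for $\kappa>0$ let $c_{\rm ww}^2(\kappa|\partial_z|)$ be the Fourier multiplier on $2\pi$-periodic functions of $z$ given by $e^{inz}\mapsto c_{\rm ww}(\kappa |n|)^2e^{inz}$, $n\in\mathbb Z$. Fix $T\ge 0$ and $\kappa>0$ such that $c_{\rm ww}(\kappa)\neq c_{\rm ww}(n\kappa)$ for all $n=2,3,\dots$ and $c_{\rm ww}(\kappa)\neq 1$. Put $$h_0=\frac34\,\frac{c_{\rm ww}(\kappa)}{c_{\rm ww}^2(\kappa)-1},\qquad h_2=\frac34\,\frac{c_{\rm ww}(\kappa)}{c_{\rm ww}^2(\kappa)-c_{\rm ww}^2(2\kappa)}.$$ Then there are $a_0>0$ and a one-parameter family $(\eta,u,c)(a;\kappa)$, $|a|<a_0$, such that for each such $a$ the functions $\eta(a;\kappa),u(a;\kappa):\mathbb R\to\mathbb R$ are smooth, even and $2\pi$-periodic, $c(a;\kappa)>0$, and $$-c\,\eta+c_{\rm ww}^2(\kappa|\partial_z|)u+u\eta=0,\qquad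 -c\,u+\eta+\tfrac12u^2=0 .$$ Moreover $c(a;\kappa)$ is smooth in $a$, $\eta(a;\kappa)(z)$ and $u(a;\kappa)(z)$ are smooth in $(a,z)$ jointly, and $$\eta(a;\kappa)(z)=a\,c_{\rm ww}(\kappa)\cos z+a^2\Big(c_{\rm ww}(\kappa)h_0-\tfrac14+\big(c_{\rm ww}(\kappa)h_2-\tfrac14\big)\cos 2z\Big)+O(a^3),$$ $$u(a;\kappa)(z)=a\cos z+a^2\big(h_0+h_2\cos 2z\big)+O(a^3),$$ $$c(a;\kappa)=c_{\rm ww}(\kappa)+\tfrac32a^2\Big(h_0+\tfrac12h_2-\frac{1}{8c_{\rm ww}(\kappa)}\Big)+O(a^3)$$ as $a\to0$, where the $O(a^3)$ remainders of $\eta$ and $u$, and each of their $z$-derivatives, are bounded by a constant (depending on $T$, $\kappa$ and the order of the derivative) times $|a|^3$, uniformly in $z\in\mathbb R$ and $|a|<a_0$. -/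

import Mathlib

open scoped ContDiff

noncomputable section

/-- Phase speed of linear gravity-capillary water waves,
`c(k) = √((1 + T k²) tanh k / k)`, extended continuously by `c(0) = 1`. -/
def cww (T k : ℝ) : ℝ :=
  if k = 0 then 1 else Real.sqrt ((1 + T * k ^ 2) * (Real.tanh k / k))

/-- `g = m(∂) f` for the Fourier multiplier with symbol `m` acting on `2π`-periodic functions:
the Fourier series `∑ m(n) f̂(n) e^{inz}` converges to `g z` at every `z`, where
`f̂(n) = (2π)⁻¹ ∫₀^{2π} f(x) e^{-inx} dx`. -/
def IsFourierMultiplierImage (m : ℤ → ℝ) (f g : ℝ → ℝ) : Prop :=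
  ∀ z : ℝ, HasSum
    (fun n : ℤ => (m n : ℂ) * fourierCoeffOn Real.two_pi_pos (fun x => (f x : ℂ)) n
      * Complex.exp (Complex.I * n * z))
    (g z : ℂ)

/-- `(η, u)` is a smooth, even, `2π`-periodic solution with speed `c > 0` of
`-c η + c_ww²(κ|∂_z|) u + u η = 0`, `-c u + η + u² / 2 = 0`. -/
structure IsEvenPeriodicTravelingWave (T κ c : ℝ) (η u : ℝ → ℝ) : Prop where
  speed_pos : 0 < c
  smooth_η : ContDiff ℝ ∞ η
  smooth_u : ContDiff ℝ ∞ u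
  even_η : Function.Even η
  even_u : Function.Even u
  periodic_η : Function.Periodic η (2 * Real.pi)
  periodic_u : Function.Periodic u (2 * Real.pi)
  eq_mass : ∃ w : ℝ → ℝ,
    IsFourierMultiplierImage (fun n : ℤ => cww T (κ * |(n : ℝ)|) ^ 2) u w ∧
      ∀ z, -c * η z + w z + u z * η z = 0
  eq_momentum : ∀ z, -c * u z + η z + 1 / 2 * u z ^ 2 = 0

/-- The coefficient `h₀ = (3/4) c(κ) / (c(κ)² - 1)`. -/
def hZero (T κ : ℝ) : ℝ := 3 / 4 * (cww T κ / (cww T κ ^ 2 - 1))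

/-- The coefficient `h₂ = (3/4) c(κ) / (c(κ)² - c(2κ)²)`. -/
def hTwo (T κ : ℝ) : ℝ := 3 / 4 * (cww T κ / (cww T κ ^ 2 - cww T (2 * κ) ^ 2))

end

/-! Eliminating `η = c u - u²/2` leaves `(c² - c_ww²(κ|∂|)) u = (3/2) c u² - u³/2`. Put `u = a cos z
+ a² H + a³ r` and `c = c₀ + a² l`, with `c₀ = c_ww(κ)`. The order `a` holds since `cos z` is in the
kernel of `L = c₀² - c_ww²(κ|∂|)`; the order `a²` is `L H = (3/2) c₀ cos² z`, solved by `H = h₀ + h₂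
cos 2z`; dividing the rest by `a³` gives `L r = R(a, l, r)`. By nonresonance the even kernel of `L`
is spanned by `cos z`, so solvability requires the `cos z` coefficient of `R` to vanish. At `a = 0`
this coefficient is affine in `l` with slope `-2 c₀ ≠ 0`. This Lyapunov–Schmidt system is a
fixed-point problem for `(l, r)`, trivial at `a = 0`, and the implicit function theorem gives the
branch (`exists_branch`). The weighted `ℓ¹` space of cosine series is closed under products, and
evaluation on it is smooth in `z` in operator norm (`contDiff_eval`). This yields joint smoothness
and uniform bounds for all derivatives. -/

noncomputable section

/-! ### Weighted cosine series and operators defined on the basis -/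

/-- The space of absolutely summable real sequences. A sequence `f` encodes the even periodic
function `z ↦ ∑ f n * 2⁻ⁿ * cos (n z)`, which is analytic in a strip. -/
abbrev Wiener : Type := lp (fun _ : ℕ => ℝ) 1

namespace Wiener

/-- The `n`-th unit sequence. -/
def basisVec (n : ℕ) : Wiener := lp.single 1 n (1 : ℝ)

theorem norm_basisVec (n : ℕ) : ‖basisVec n‖ = 1 := by
  simp [basisVec, lp.norm_single]

theorem basisVec_apply (n k : ℕ) : basisVec n k = if k = n then 1 else 0 := by
  rw [basisVec, lp.single_apply, Pi.single_apply]

theorem hasSum_norm (f : Wiener) : HasSum (fun n => ‖f n‖) ‖f‖ := by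
  simpa using lp.hasSum_norm (p := 1) (by simp) f

section lift

variable {B : Type*} [NormedAddCommGroup B] [NormedSpace ℝ B]

theorem summable_smul {b : ℕ → B} {K : ℝ} (hb : ∀ n, ‖b n‖ ≤ K) (f : Wiener) :
    Summable fun n => ‖f n • b n‖ := by
  refine Summable.of_nonneg_of_le (fun _ => norm_nonneg _) (fun n => ?_)
    ((hasSum_norm f).summable.mul_right K)
  rw [norm_smul]
  gcongr
  exact hb n

/-- Each sequence is the norm limit of its truncations. Operator identities below thereby reduce to
single cosines. -/
theorem clm_ext {S S' : Wiener →L[ℝ] B} (h : ∀ n, S (basisVec n) = S' (basisVec n)) : S = S' := by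
  ext f
  have hf := lp.hasSum_single (p := 1) (by simp) f
  have e : ∀ n, lp.single 1 n (f n) = f n • basisVec n := fun n => by
    rw [basisVec, ← lp.single_smul, smul_eq_mul, mul_one]
  simp only [e] at hf
  refine (hf.mapL S).unique ?_
  simpa [h] using hf.mapL S'

variable [CompleteSpace B]

/-- The continuous linear map sending the `n`-th unit sequence to `b n`. -/
def lift (b : ℕ → B) (K : ℝ) (hb : ∀ n, ‖b n‖ ≤ K) : Wiener →L[ℝ] B :=
  LinearMap.mkContinuous
    { toFun := fun f => ∑' n, f n • b n
      map_add' := fun f g => by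
        rw [← (summable_smul hb f).of_norm.tsum_add (summable_smul hb g).of_norm]
        simp [add_smul]
      map_smul' := fun c f => by
        rw [RingHom.id_apply, ← (summable_smul hb f).of_norm.tsum_const_smul]
        simp [mul_smul] }
    K fun f => by
      refine (norm_tsum_le_tsum_norm (summable_smul hb f)).trans ?_
      refine hasSum_le (fun n => ?_) (summable_smul hb f).hasSum ((hasSum_norm f).mul_left K)
      rw [norm_smul, mul_comm]
      gcongr
      exact hb n

theorem hasSum_lift (b : ℕ → B) (K : ℝ) (hb : ∀ n, ‖b n‖ ≤ K) (f : Wiener) :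
    HasSum (fun n => f n • b n) (lift b K hb f) :=
  (summable_smul hb f).of_norm.hasSum

theorem lift_basisVec (b : ℕ → B) (K : ℝ) (hb : ∀ n, ‖b n‖ ≤ K) (n : ℕ) :
    lift b K hb (basisVec n) = b n := by
  refine (hasSum_lift b K hb _).unique ?_
  convert hasSum_ite_eq n (b n) using 2 with k
  rw [basisVec_apply]
  split_ifs with h <;> simp [h]

theorem norm_lift_le (b : ℕ → B) (K : ℝ) (hb : ∀ n, ‖b n‖ ≤ K) : ‖lift b K hb‖ ≤ K :=
  LinearMap.mkContinuous_norm_le _ ((norm_nonneg _).trans (hb 0)) _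

end lift

/-- The `n`-th entry as a continuous linear functional. -/
def coord (n : ℕ) : Wiener →L[ℝ] ℝ :=
  lift (fun k => if k = n then 1 else 0) 1 fun k => by split_ifs <;> simp

theorem coord_apply (n : ℕ) (f : Wiener) : coord n f = f n := by
  refine (hasSum_lift _ _ _ f).unique ?_
  have e : (fun k => f k • (if k = n then (1 : ℝ) else 0)) = fun k => if k = n then f n else 0 := by
    ext k
    split_ifs with h <;> simp [h]
  rw [e]
  exact hasSum_ite_eq n (f n)

theorem norm_coord_le (n : ℕ) : ‖coord n‖ ≤ 1 := norm_lift_le _ _ _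

/-- The sequence encoding `z ↦ cos (n z)`. -/
def cosVec (n : ℕ) : Wiener := (2 : ℝ) ^ n • basisVec n

theorem basisVec_eq (n : ℕ) : basisVec n = (1 / 2 : ℝ) ^ n • cosVec n := by
  rw [cosVec, smul_smul, ← mul_pow]
  norm_num

theorem cosVec_apply (n k : ℕ) : cosVec n k = if k = n then 2 ^ n else 0 := by
  simp [cosVec, basisVec_apply]

theorem norm_cosVec (n : ℕ) : ‖cosVec n‖ = 2 ^ n := by
  simp [cosVec, norm_smul, norm_basisVec]

/-! ### Pointwise evaluation -/

/-- Evaluation at `z` of the function encoded by a sequence. -/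
def eval (z : ℝ) : Wiener →L[ℝ] ℝ :=
  lift (fun n => (1 / 2) ^ n * Real.cos (n * z)) 1 fun n => by
    rw [norm_mul, norm_pow]
    refine mul_le_one₀ (pow_le_one₀ (norm_nonneg _) (by norm_num)) (norm_nonneg _) ?_
    exact Real.abs_cos_le_one _

theorem eval_basisVec (z : ℝ) (n : ℕ) : eval z (basisVec n) = (1 / 2) ^ n * Real.cos (n * z) :=
  lift_basisVec _ _ _ n

theorem eval_cosVec (z : ℝ) (n : ℕ) : eval z (cosVec n) = Real.cos (n * z) := by
  rw [cosVec, map_smul, eval_basisVec, smul_eq_mul, ← mul_assoc, ← mul_pow]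
  norm_num

theorem hasSum_eval (z : ℝ) (f : Wiener) :
    HasSum (fun n => f n * ((1 / 2) ^ n * Real.cos (n * z))) (eval z f) :=
  hasSum_lift _ _ _ f

theorem eval_neg (z : ℝ) : eval (-z) = eval z :=
  clm_ext fun n => by simp [eval_basisVec]

theorem eval_add_two_pi (z : ℝ) : eval (z + 2 * Real.pi) = eval z :=
  clm_ext fun n => by
    rw [eval_basisVec, eval_basisVec, mul_add, Real.cos_add_nat_mul_two_pi]

/-! ### Multiplication -/

/-- The product of the unit sequences `k` and `l`, by the product formula for cosines. -/
def basisMul (k l : ℕ) : Wiener :=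
  (1 / 2 : ℝ) ^ (k + l) • (1 / 2 : ℝ) • (cosVec (k + l) + cosVec (k - l + (l - k)))

/-- The weight is submultiplicative: both frequencies `k + l` and `|k - l|`, the latter written with
truncated subtraction, are at most `k + l`. -/
theorem norm_basisMul_le (k l : ℕ) : ‖basisMul k l‖ ≤ 1 := by
  have h : ‖cosVec (k + l) + cosVec (k - l + (l - k))‖ ≤ 2 ^ (k + l) + 2 ^ (k + l) := by
    refine (norm_add_le _ _).trans ?_
    rw [norm_cosVec, norm_cosVec]
    gcongr
    · norm_num
    all_goals omega
  rw [basisMul, norm_smul, norm_smul, norm_pow]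
  calc _ ≤ ‖(1 / 2 : ℝ)‖ ^ (k + l) * (‖(1 / 2 : ℝ)‖ * (2 ^ (k + l) + 2 ^ (k + l))) := by gcongr
    _ = (1 / 2 * 2 : ℝ) ^ (k + l) := by rw [mul_pow]; norm_num; ring
    _ = 1 := by norm_num

/-- Multiplication of the encoded functions, as a bilinear map. -/
def mulCLM : Wiener →L[ℝ] Wiener →L[ℝ] Wiener :=
  lift (fun k => lift (basisMul k) 1 (norm_basisMul_le k)) 1 fun _ => norm_lift_le _ _ _

theorem mulCLM_cosVec (k l : ℕ) :
    mulCLM (cosVec k) (cosVec l) =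
      (1 / 2 : ℝ) • (cosVec (k + l) + cosVec (k - l + (l - k))) := by
  have : mulCLM (basisVec k) (basisVec l) = basisMul k l := by
    rw [mulCLM, lift_basisVec, lift_basisVec]
  conv_lhs => rw [cosVec, cosVec, map_smul, map_smul, smul_apply, this,
    basisMul, smul_smul, smul_smul]
  rw [← pow_add, add_comm l k, ← mul_pow]
  norm_num

theorem eval_mulCLM (z : ℝ) (f g : Wiener) : eval z (mulCLM f g) = eval z f * eval z g := by
  have cosine : ∀ k l : ℕ, eval z (mulCLM (cosVec k) (cosVec l))
      = eval z (cosVec k) * eval z (cosVec l) := by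
    intro k l
    rw [mulCLM_cosVec, map_smul, map_add, eval_cosVec, eval_cosVec, eval_cosVec, eval_cosVec]
    have h : Real.cos (((k - l + (l - k) : ℕ) : ℝ) * z) = Real.cos (k * z - l * z) := by
      rcases le_total k l with hkl | hkl
      · rw [Nat.sub_eq_zero_of_le hkl, zero_add, Nat.cast_sub hkl, ← Real.cos_neg]
        ring_nf
      · rw [Nat.sub_eq_zero_of_le hkl, add_zero, Nat.cast_sub hkl]
        ring_nf
    rw [h, Nat.cast_add, add_mul, Real.cos_add, Real.cos_sub, smul_eq_mul]
    ring
  have basis : ∀ k l : ℕ, eval z (mulCLM (basisVec k) (basisVec l))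
      = eval z (basisVec k) * eval z (basisVec l) := by
    intro k l
    simp only [basisVec_eq, map_smul, smul_apply, cosine, smul_eq_mul]
    ring
  have right : ∀ (f : Wiener) (l : ℕ), eval z (mulCLM f (basisVec l))
      = eval z f * eval z (basisVec l) := by
    intro f l
    have : (eval z).comp (mulCLM.flip (basisVec l)) = eval z (basisVec l) • eval z :=
      clm_ext fun k => by simp [basis, mul_comm]
    simpa [mul_comm] using DFunLike.congr_fun this f
  have : (eval z).comp (mulCLM f) = eval z f • eval z := clm_ext fun l => by simp [right]
  simpa using DFunLike.congr_fun this g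

/-! ### Smoothness of evaluation and derivative bounds -/

theorem eval_eq_tsum (z : ℝ) :
    eval z = ∑' n : ℕ, ((1 / 2 : ℝ) ^ n * Real.cos (n * z)) • coord n := by
  have hs : Summable fun n : ℕ => ((1 / 2 : ℝ) ^ n * Real.cos (n * z)) • coord n := by
    refine Summable.of_norm_bounded summable_geometric_two fun n => ?_
    rw [norm_smul, norm_mul, Real.norm_of_nonneg (by positivity : (0 : ℝ) ≤ (1 / 2) ^ n)]
    have h1 : ‖Real.cos (n * z)‖ ≤ 1 := Real.abs_cos_le_one _
    calc _ ≤ (1 / 2 : ℝ) ^ n * 1 * 1 := by gcongr; exact norm_coord_le n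
      _ = _ := by ring
  ext f
  refine (hasSum_eval z f).unique ?_
  have := hs.hasSum.mapL (ContinuousLinearMap.apply ℝ ℝ f)
  simpa [coord_apply, mul_comm] using this

/-- Each `z`-derivative costs a factor `n`, and the geometric weight absorbs every power of `n`.
Smoothness is in operator norm, so it combines with smoothness of a family of sequences. -/
theorem contDiff_eval : ContDiff ℝ ∞ eval := by
  rw [show eval = fun z => ∑' n : ℕ, ((1 / 2 : ℝ) ^ n * Real.cos (n * z)) • coord n from
    funext eval_eq_tsum]
  refine contDiff_tsum (𝕜 := ℝ) (N := (⊤ : ℕ∞))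
    (f := fun (n : ℕ) (z : ℝ) => ((1 / 2 : ℝ) ^ n * Real.cos (n * z)) • coord n)
    (v := fun k n => (n : ℝ) ^ k * (1 / 2) ^ n) (fun n => ?_) (fun k _ => ?_) ?_
  · exact ((contDiff_const.mul (Real.contDiff_cos.comp (contDiff_const.mul contDiff_id)))).smul
      contDiff_const
  · exact summable_pow_mul_geometric_of_norm_lt_one k (by norm_num)
  · intro k n z _
    rw [norm_iteratedFDeriv_eq_norm_iteratedDeriv]
    have hc : ContDiff ℝ k fun z : ℝ => Real.cos (n * z) :=
      Real.contDiff_cos.comp (contDiff_const.mul contDiff_id)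
    have e : iteratedDeriv k (fun z : ℝ => ((1 / 2 : ℝ) ^ n * Real.cos (n * z)) • coord n) z
        = ((1 / 2 : ℝ) ^ n * ((n : ℝ) ^ k * iteratedDeriv k Real.cos (n * z))) • coord n := by
      rw [iteratedDeriv_smul_const, iteratedDeriv_const_mul_field,
        iteratedDeriv_comp_const_mul Real.contDiff_cos]
      exact (contDiff_const.mul hc).contDiffAt
    rw [e, norm_smul, norm_mul, norm_mul, Real.norm_of_nonneg (by positivity : (0 : ℝ) ≤ (1 / 2) ^ n),
      Real.norm_of_nonneg (by positivity : (0 : ℝ) ≤ (n : ℝ) ^ k)]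
    have h1 : ‖iteratedDeriv k Real.cos (n * z)‖ ≤ 1 := Real.abs_iteratedDeriv_cos_le_one _ _
    calc _ ≤ (1 / 2 : ℝ) ^ n * ((n : ℝ) ^ k * 1) * 1 := by gcongr; exact norm_coord_le n
      _ = _ := by ring

theorem iteratedDeriv_eval (k : ℕ) (f : Wiener) (z : ℝ) :
    iteratedDeriv k (fun x => eval x f) z = iteratedDeriv k eval z f := by
  have h := (ContinuousLinearMap.apply ℝ ℝ f).iteratedFDeriv_comp_left
    (contDiff_eval.contDiffAt (x := z)) (i := k) (by exact_mod_cast le_top)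
  have := congr_arg (fun φ => φ fun _ => (1 : ℝ)) h
  simpa [iteratedDeriv_eq_iteratedFDeriv, Function.comp_def] using this

/-- A continuous periodic function is bounded; this is the source of uniformity in `z`. -/
theorem exists_norm_iteratedDeriv_eval_le (k : ℕ) : ∃ K : ℝ, ∀ z, ‖iteratedDeriv k eval z‖ ≤ K := by
  have hp : Function.Periodic (iteratedDeriv k eval) (2 * Real.pi) := fun z => by
    have h := congr_fun (iteratedDeriv_comp_add_const (n := k) (f := eval) (s := 2 * Real.pi)) z
    simp only [eval_add_two_pi] at h
    exact h.symm
  have hc : Continuous (iteratedDeriv k eval) :=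
    contDiff_eval.continuous_iteratedDeriv k (by exact_mod_cast le_top)
  obtain ⟨K, hK⟩ := (hp.isBounded_of_continuous Real.two_pi_pos.ne' hc).exists_norm_le
  exact ⟨K, fun z => hK _ ⟨z, rfl⟩⟩

theorem exists_abs_iteratedDeriv_eval_le (k : ℕ) :
    ∃ K : ℝ, 0 ≤ K ∧ ∀ (f : Wiener) (z : ℝ),
      |iteratedDeriv k (fun x => eval x f) z| ≤ K * ‖f‖ := by
  obtain ⟨K, hK⟩ := exists_norm_iteratedDeriv_eval_le k
  refine ⟨K, (norm_nonneg _).trans (hK 0), fun f z => ?_⟩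
  rw [iteratedDeriv_eval, ← Real.norm_eq_abs]
  exact ((iteratedDeriv k eval z).le_opNorm f).trans (by gcongr; exact hK z)

/-! ### Fourier coefficients and multipliers -/

/-- The ratio between the `n`-th complex Fourier coefficient of the encoded function and the
`|n|`-th entry of the sequence. -/
def fourierWeight (n : ℤ) : ℝ := (1 / 2) ^ n.natAbs * if n = 0 then 1 else 1 / 2

theorem integral_exp_int_mul (m : ℤ) :
    ∫ x in (0 : ℝ)..2 * Real.pi, Complex.exp (m * Complex.I * x) =
      if m = 0 then (2 * Real.pi : ℂ) else 0 := by
  split_ifs with h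
  · simp [h]
  · have hm : (m : ℂ) * Complex.I ≠ 0 := by simp [h]
    rw [integral_exp_mul_complex hm]
    have : (m : ℂ) * Complex.I * ((2 * Real.pi : ℝ) : ℂ) = m * (2 * Real.pi * Complex.I) := by
      push_cast; ring
    rw [this, Complex.exp_int_mul_two_pi_mul_I]
    simp

theorem integral_exp_mul_cos (n : ℤ) (k : ℕ) :
    ∫ x in (0 : ℝ)..2 * Real.pi, Complex.exp ((-n : ℤ) * Complex.I * x) * (Real.cos (k * x) : ℂ) =
      2 * Real.pi * if k = n.natAbs then ((if n = 0 then 1 else 1 / 2 : ℝ) : ℂ) else 0 := by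
  have e : ∀ x : ℝ, Complex.exp ((-n : ℤ) * Complex.I * x) * (Real.cos (k * x) : ℂ) =
      1 / 2 * (Complex.exp ((k - n : ℤ) * Complex.I * x)
        + Complex.exp ((-k - n : ℤ) * Complex.I * x)) := by
    intro x
    have h1 : (((k - n : ℤ) : ℂ) * Complex.I * x)
        = ((-n : ℤ) : ℂ) * Complex.I * x + k * x * Complex.I := by push_cast; ring
    have h2 : (((-k - n : ℤ) : ℂ) * Complex.I * x)
        = ((-n : ℤ) : ℂ) * Complex.I * x + -(k * x) * Complex.I := by push_cast; ring
    rw [h1, h2, Complex.exp_add, Complex.exp_add, Complex.ofReal_cos, Complex.cos]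
    push_cast
    ring
  have hi : ∀ m : ℤ, IntervalIntegrable (fun x : ℝ => Complex.exp (m * Complex.I * x))
      MeasureTheory.volume 0 (2 * Real.pi) := fun m =>
    (by fun_prop : Continuous fun x : ℝ => Complex.exp (m * Complex.I * x)).intervalIntegrable _ _
  simp only [e]
  rw [intervalIntegral.integral_const_mul, intervalIntegral.integral_add (hi _) (hi _),
    integral_exp_int_mul, integral_exp_int_mul]
  by_cases h0 : n = 0
  · by_cases hk : k = 0
    · simp [h0, hk]; ring
    · simp [h0, hk]
  · by_cases hk : k = n.natAbs
    · rcases Int.natAbs_eq n with hn | hn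
      · rw [if_pos (by omega), if_neg (by omega), if_pos hk, if_neg h0]; push_cast; ring
      · rw [if_neg (by omega), if_pos (by omega), if_pos hk, if_neg h0]; push_cast; ring
    · rw [if_neg (by omega), if_neg (by omega), if_neg hk]; simp

/-- The integral is taken in the space of functionals, so it suffices to compute it on single
cosines, without exchanging sum and integral by hand. -/
theorem fourierCoeffOn_eval (f : Wiener) (n : ℤ) :
    fourierCoeffOn Real.two_pi_pos (fun x => (eval x f : ℂ)) n
      = ((f n.natAbs * fourierWeight n : ℝ) : ℂ) := by
  set φ : ℝ → Wiener →L[ℝ] ℂ := fun x =>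
    Complex.exp ((-n : ℤ) * Complex.I * x) • Complex.ofRealCLM.comp (eval x) with hφ
  have hc : Continuous φ := by
    have := contDiff_eval.continuous
    fun_prop
  have hint : ∫ x in (0 : ℝ)..2 * Real.pi, φ x
      = (2 * Real.pi : ℝ) • (fourierWeight n • Complex.ofRealCLM.comp (coord n.natAbs)) := by
    refine clm_ext fun k => ?_
    rw [ContinuousLinearMap.intervalIntegral_apply (hc.intervalIntegrable _ _)]
    have e : ∀ x : ℝ, φ x (basisVec k) = (1 / 2 : ℂ) ^ k *
        (Complex.exp ((-n : ℤ) * Complex.I * x) * (Real.cos (k * x) : ℂ)) := by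
      intro x
      simp only [hφ, smul_apply, ContinuousLinearMap.comp_apply, eval_basisVec,
        Complex.ofRealCLM_apply, smul_eq_mul]
      push_cast
      ring
    simp only [e]
    rw [intervalIntegral.integral_const_mul, integral_exp_mul_cos]
    simp only [smul_apply, ContinuousLinearMap.comp_apply, coord_apply, basisVec_apply,
      fourierWeight, Complex.ofRealCLM_apply, Complex.real_smul]
    by_cases hk : k = n.natAbs
    · rw [if_pos hk, if_pos hk.symm, hk]; push_cast; ring
    · rw [if_neg hk, if_neg (Ne.symm hk)]; simp
  rw [fourierCoeffOn_eq_integral]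
  have e : ∀ x : ℝ, fourier (-n) (x : AddCircle (2 * Real.pi - 0)) • (eval x f : ℂ) = φ x f := by
    intro x
    rw [fourier_coe_apply, hφ]
    simp only [smul_apply, ContinuousLinearMap.comp_apply, Complex.ofRealCLM_apply]
    congr 2
    have : (Real.pi : ℂ) ≠ 0 := by exact_mod_cast Real.pi_ne_zero
    push_cast
    field_simp
    ring
  simp only [e]
  rw [← ContinuousLinearMap.intervalIntegral_apply (hc.intervalIntegrable _ _), hint]
  simp only [smul_apply, ContinuousLinearMap.comp_apply, coord_apply, Complex.ofRealCLM_apply,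
    Complex.real_smul]
  have : (Real.pi : ℂ) ≠ 0 := by exact_mod_cast Real.pi_ne_zero
  push_cast
  field_simp
  ring

theorem hasSum_fourierWeight (f : Wiener) (z : ℝ) :
    HasSum (fun n : ℤ => ((f n.natAbs * fourierWeight n : ℝ) : ℂ)
      * Complex.exp (Complex.I * n * z)) (eval z f : ℂ) := by
  set g : ℤ → ℂ := fun n => ((f n.natAbs * fourierWeight n : ℝ) : ℂ)
      * Complex.exp (Complex.I * n * z) with hg
  have hb : ∀ n : ℤ, ‖g n‖ ≤ ‖f n.natAbs‖ := by
    intro n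
    have h1 : ‖Complex.exp (Complex.I * n * z)‖ = 1 := by
      rw [show Complex.I * n * z = ((n * z : ℝ) : ℂ) * Complex.I by push_cast; ring,
        Complex.norm_exp_ofReal_mul_I]
    have h2 : ‖fourierWeight n‖ ≤ 1 := by
      rw [fourierWeight, norm_mul, norm_pow]
      refine mul_le_one₀ (pow_le_one₀ (norm_nonneg _) (by norm_num)) (norm_nonneg _) ?_
      split_ifs <;> norm_num
    rw [hg, norm_mul, h1, mul_one, Complex.norm_real, norm_mul]
    exact mul_le_of_le_one_right (norm_nonneg _) h2
  have hp : Summable fun n : ℕ => g n := by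
    refine Summable.of_norm_bounded (hasSum_norm f).summable fun n => ?_
    simpa using hb n
  have hm : Summable fun n : ℕ => g (-n) := by
    refine Summable.of_norm_bounded (hasSum_norm f).summable fun n => ?_
    simpa using hb (-n)
  have hsum := HasSum.of_nat_of_neg hp.hasSum hm.hasSum
  -- Summing over `n` and `-n` counts the zero frequency twice; this term corrects it.
  have h0 : HasSum (fun n : ℕ => if n = 0 then g 0 else 0) (g 0) := hasSum_ite_eq 0 (g 0)
  have hE := (Complex.ofRealCLM.hasSum (hasSum_eval z f))
  have e : (⇑Complex.ofRealCLM ∘ fun n => f n * ((1 / 2) ^ n * Real.cos (n * z)))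
      = fun n : ℕ => g n + g (-n) - if n = 0 then g 0 else 0 := by
    ext n
    simp only [Function.comp, hg, fourierWeight, Complex.ofRealCLM_apply]
    rcases Nat.eq_zero_or_pos n with rfl | hn
    · simp
    · have hn' : (n : ℤ) ≠ 0 := by omega
      simp only [Int.natAbs_natCast, Int.natAbs_neg, neg_eq_zero, hn', hn.ne', if_false]
      have h1 : Complex.I * ((n : ℤ) : ℂ) * z = n * z * Complex.I := by push_cast; ring
      have h2 : Complex.I * ((-(n : ℤ) : ℤ) : ℂ) * z = -(n * z) * Complex.I := by push_cast; ring
      rw [h1, h2]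
      push_cast [Complex.cos]
      ring
  have : (eval z f : ℂ) = _ := hE.unique (e ▸ (hp.hasSum.add hm.hasSum).sub h0)
  rwa [this]

/-- If the entries of `g` are those of `f` multiplied by `m |n|`, then the function encoded by `g`
is the image of the one encoded by `f` under the Fourier multiplier with symbol `m |n|`. -/
theorem isFourierMultiplierImage_eval (m : ℝ → ℝ) (f g : Wiener) (h : ∀ n : ℕ, g n = m n * f n) :
    IsFourierMultiplierImage (fun n : ℤ => m |(n : ℝ)|) (fun z => eval z f)
      (fun z => eval z g) := by
  intro z
  convert hasSum_fourierWeight g z using 2 with n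
  rw [fourierCoeffOn_eval, h, Nat.cast_natAbs, Int.cast_abs]
  push_cast
  ring

end Wiener

/-! ### The dispersion relation -/

theorem Real.tanh_pos {x : ℝ} (hx : 0 < x) : 0 < Real.tanh x := by
  rw [Real.tanh_eq_sinh_div_cosh]
  exact div_pos (Real.sinh_pos_iff.2 hx) (Real.cosh_pos x)

theorem Real.tanh_mono : Monotone Real.tanh := by
  intro x y h
  rw [← Real.artanh_tanh x, ← Real.artanh_tanh y,
    Real.artanh_le_artanh_iff ⟨Real.neg_one_lt_tanh x, Real.tanh_lt_one x⟩
      ⟨Real.neg_one_lt_tanh y, Real.tanh_lt_one y⟩] at h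
  exact h

theorem cww_nonneg (T k : ℝ) : 0 ≤ cww T k := by
  unfold cww
  split_ifs
  · exact zero_le_one
  · exact Real.sqrt_nonneg _

theorem cww_sq {T k : ℝ} (hT : 0 ≤ T) (hk : 0 < k) :
    cww T k ^ 2 = (1 + T * k ^ 2) * (Real.tanh k / k) := by
  rw [cww, if_neg hk.ne', Real.sq_sqrt]
  have := Real.tanh_pos hk
  positivity

theorem cww_pos {T k : ℝ} (hT : 0 ≤ T) (hk : 0 < k) : 0 < cww T k := by
  refine lt_of_le_of_ne (cww_nonneg T k) fun h => ?_
  have h1 := cww_sq hT hk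
  have := Real.tanh_pos hk
  have : 0 < (1 + T * k ^ 2) * (Real.tanh k / k) := by positivity
  rw [← h1, ← h] at this
  norm_num at this

open Filter Topology in
/-- The inverse of the linearized operator on cosines of frequency different from `1` is bounded. -/
theorem exists_abs_inv_sub_cww_sq_le {T κ : ℝ} (hT : 0 ≤ T) (hκ : 0 < κ) :
    ∃ K : ℝ, ∀ n : ℕ, |(cww T κ ^ 2 - cww T (κ * n) ^ 2)⁻¹| ≤ K := by
  have hx : Tendsto (fun n : ℕ => κ * (n : ℝ)) atTop atTop :=
    tendsto_natCast_atTop_atTop.const_mul_atTop hκ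
  -- A convergent sequence is bounded. As `n → ∞`, `c_ww(κ n)²` tends to `0` if `T = 0` and to
  -- infinity if `T > 0`.
  have hlim : ∃ l, Tendsto (fun n : ℕ => (cww T κ ^ 2 - cww T (κ * n) ^ 2)⁻¹) atTop (𝓝 l) := by
    rcases hT.eq_or_lt with rfl | hT'
    · refine ⟨(cww 0 κ ^ 2 - 0)⁻¹, Tendsto.inv₀ (tendsto_const_nhds.sub ?_) ?_⟩
      · refine squeeze_zero' (Eventually.of_forall fun _ => sq_nonneg _) ?_
          (tendsto_inv_atTop_zero.comp hx)
        filter_upwards [hx.eventually_gt_atTop 0] with n hn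
        rw [cww_sq le_rfl hn, zero_mul, add_zero, one_mul, Function.comp, div_eq_mul_inv]
        exact mul_le_of_le_one_left (by positivity) (Real.tanh_lt_one _).le
      · have := cww_pos (le_refl (0 : ℝ)) hκ
        rw [sub_zero]
        positivity
    · refine ⟨0, Tendsto.comp tendsto_inv_atBot_zero ?_⟩
      refine tendsto_atBot_add_const_left _ _ (tendsto_neg_atTop_atBot.comp ?_)
      have hk := Real.tanh_pos hκ
      refine tendsto_atTop_mono' _ ?_ (hx.const_mul_atTop (mul_pos hT' hk))
      filter_upwards [eventually_ge_atTop 1] with n hn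
      have hn1 : (1 : ℝ) ≤ n := by exact_mod_cast hn
      have hk1 : κ ≤ κ * n := le_mul_of_one_le_right hκ.le hn1
      have hk0 : 0 < κ * n := hκ.trans_le hk1
      have hm := Real.tanh_mono hk1
      rw [cww_sq hT hk0]
      calc T * Real.tanh κ * (κ * n) ≤ T * Real.tanh (κ * n) * (κ * n) := by gcongr
        _ = T * (κ * n) ^ 2 * (Real.tanh (κ * n) / (κ * n)) := by field_simp
        _ ≤ (1 + T * (κ * n) ^ 2) * (Real.tanh (κ * n) / (κ * n)) := by
          have := Real.tanh_pos hk0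
          gcongr
          linarith
  obtain ⟨l, hl⟩ := hlim
  obtain ⟨K, hK⟩ := (Metric.isBounded_range_of_tendsto _ hl).exists_norm_le
  exact ⟨K, fun n => hK _ ⟨n, rfl⟩⟩

/-! ### Fixed points by the implicit function theorem -/

open Filter Topology in
/-- An analytic map `Ψ` on a product, constant on the fibre over `0`, has an analytic family of
fixed points. -/
theorem exists_contDiffAt_fixedPoint {Y : Type*} [NormedAddCommGroup Y] [NormedSpace ℝ Y]
    [CompleteSpace Y] {Ψ : ℝ × Y → Y} (hΨ : ContDiff ℝ ω Ψ) {y₀ : Y} (h₀ : ∀ y, Ψ (0, y) = y₀) :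
    ∃ φ : ℝ → Y, φ 0 = y₀ ∧ ContDiffAt ℝ ω φ 0 ∧ ∀ᶠ a in 𝓝 0, Ψ (a, φ a) = φ a := by
  set F : ℝ × Y → Y := fun p => p.2 - Ψ p with hF
  have hc : ContDiffAt ℝ ω F (0, y₀) := (contDiff_snd.sub hΨ).contDiffAt
  have hω : (ω : WithTop ℕ∞) ≠ 0 := by simp
  -- On the fibre over `0` the map `F` is the translation `y ↦ y - y₀`, whose derivative is the
  -- identity.
  have hd : fderiv ℝ F (0, y₀) ∘L .inr ℝ ℝ Y = ContinuousLinearMap.id ℝ Y := by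
    have h1 : HasFDerivAt F (fderiv ℝ F (0, y₀)) (0, y₀) :=
      (hc.differentiableAt hω).hasFDerivAt
    have h2 : HasFDerivAt (fun y : Y => ((0 : ℝ), y)) (.inr ℝ ℝ Y) y₀ :=
      hasFDerivAt_prodMk_right 0 y₀
    have h3 := h1.comp y₀ h2
    have h4 : F ∘ (fun y : Y => ((0 : ℝ), y)) = fun y => y - y₀ := by
      ext y
      simp [hF, h₀]
    rw [h4] at h3
    exact h3.unique ((hasFDerivAt_id y₀).sub_const y₀)
  have hinv : (fderiv ℝ F (0, y₀) ∘L .inr ℝ ℝ Y).IsInvertible := by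
    rw [hd]
    exact ⟨.refl ℝ Y, rfl⟩
  refine ⟨hc.implicitFunction hω hinv, hc.implicitFunction_apply_self hω hinv,
    hc.contDiffAt_implicitFunction hω hinv, ?_⟩
  filter_upwards [hc.eventually_apply_implicitFunction hω hinv] with a ha
  simp only [hF, h₀, sub_self] at ha
  exact (sub_eq_zero.1 ha).symm

/-! ### Lyapunov–Schmidt reduction -/

namespace Wiener

/-- The second-order profile `h₀ + h₂ cos 2z`. -/
def secondProfile (T κ : ℝ) : Wiener := hZero T κ • cosVec 0 + hTwo T κ • cosVec 2

/-- The right-hand side `R` of the equation `(c₀² - c_ww²(κ|∂|)) r = R` which is satisfied by the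
remainder `r` of the wave `u = a cos z + a² H + a³ r` travelling with speed `c₀ + a² l`. -/
def residual (c₀ : ℝ) (H : Wiener) (a l : ℝ) (r : Wiener) : Wiener :=
  -(2 * c₀ * l + a ^ 2 * l ^ 2) • (cosVec 1 + a • H + a ^ 2 • r)
    + (3 / 2 * c₀) • ((2 : ℝ) • mulCLM (cosVec 1) (H + a • r)
      + a • mulCLM (H + a • r) (H + a • r))
    + (3 / 2 * a * l) • mulCLM (cosVec 1 + a • H + a ^ 2 • r) (cosVec 1 + a • H + a ^ 2 • r)
    - (1 / 2 : ℝ) • mulCLM (cosVec 1 + a • H + a ^ 2 • r)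
      (mulCLM (cosVec 1 + a • H + a ^ 2 • r) (cosVec 1 + a • H + a ^ 2 • r))

theorem contDiff_residual (c₀ : ℝ) (H : Wiener) :
    ContDiff ℝ ω fun p : ℝ × ℝ × Wiener => residual c₀ H p.1 p.2.1 p.2.2 := by
  unfold residual
  fun_prop

/-- At `a = 0` the remainder `r` drops out and `l` enters only along `cos z`, which makes the
fixed-point map constant on that fibre. -/
theorem residual_zero (c₀ : ℝ) (H : Wiener) (l : ℝ) (r : Wiener) :
    residual c₀ H 0 l r = -(2 * c₀ * l) • cosVec 1 + ((3 * c₀) • mulCLM (cosVec 1) H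
      - (1 / 2 : ℝ) • mulCLM (cosVec 1) (mulCLM (cosVec 1) (cosVec 1))) := by
  simp only [residual, zero_smul, add_zero, smul_smul, ne_eq, OfNat.ofNat_ne_zero,
    not_false_eq_true, zero_pow, zero_mul, mul_zero]
  rw [show 3 / 2 * c₀ * 2 = 3 * c₀ by ring, add_sub_assoc]

/-- The branch of remainders and speed corrections produced by the implicit function theorem. -/
theorem exists_branch {T κ : ℝ} (hT : 0 ≤ T) (hκ : 0 < κ)
    (hres : ∀ n : ℕ, n ≠ 1 → cww T κ ^ 2 - cww T (κ * n) ^ 2 ≠ 0) :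
    ∃ (l : ℝ → ℝ) (r : ℝ → Wiener), ContDiffAt ℝ ω l 0 ∧ ContDiffAt ℝ ω r 0 ∧
      l 0 = 3 / 2 * (hZero T κ + 1 / 2 * hTwo T κ - 1 / (8 * cww T κ)) ∧
      ∀ᶠ a in nhds 0, ∀ n : ℕ, (cww T κ ^ 2 - cww T (κ * n) ^ 2) * r a n
        = residual (cww T κ) (secondProfile T κ) a (l a) (r a) n := by
  obtain ⟨K, hK⟩ := exists_abs_inv_sub_cww_sq_le hT hκ
  set c₀ := cww T κ with hc₀
  have hpos : 0 < c₀ := cww_pos hT hκ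
  set H := secondProfile T κ with hH
  -- At `n = 1` the convention `0⁻¹ = 0` applies: `G` annihilates `cos z` and inverts the linear
  -- operator on the other frequencies.
  set G : Wiener →L[ℝ] Wiener :=
    lift (fun n => (c₀ ^ 2 - cww T (κ * n) ^ 2)⁻¹ • basisVec n) K fun n => by
      rw [norm_smul, norm_basisVec, mul_one]; exact hK n with hG
  have hGb : ∀ n, G (basisVec n) = (c₀ ^ 2 - cww T (κ * n) ^ 2)⁻¹ • basisVec n :=
    fun n => lift_basisVec _ _ _ n
  have hGn : ∀ (f : Wiener) (n : ℕ), G f n = (c₀ ^ 2 - cww T (κ * n) ^ 2)⁻¹ * f n := by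
    intro f n
    have : (coord n).comp G = (c₀ ^ 2 - cww T (κ * n) ^ 2)⁻¹ • coord n := by
      refine clm_ext fun k => ?_
      simp only [ContinuousLinearMap.comp_apply, hGb, map_smul, smul_apply, coord_apply,
        basisVec_apply]
      by_cases h : n = k
      · rw [h]
      · simp [h]
    simpa [coord_apply] using DFunLike.congr_fun this f
  have hG1 : G (cosVec 1) = 0 := by
    rw [cosVec, map_smul, hGb, Nat.cast_one, mul_one, ← hc₀, sub_self, inv_zero, zero_smul,
      smul_zero]
  -- Entry `1` of `cosVec 1` is `2`, so the term `-2 c₀ l cos z` contributes `-4 c₀ l`; dividing by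
  -- `4 c₀` cancels `l` at `a = 0`. A fixed point has vanishing `cos z` entry in the residual.
  set Ψ : ℝ × ℝ × Wiener → ℝ × Wiener := fun p =>
    (p.2.1 + coord 1 (residual c₀ H p.1 p.2.1 p.2.2) / (4 * c₀),
      G (residual c₀ H p.1 p.2.1 p.2.2)) with hΨ
  have hsmooth : ContDiff ℝ ω Ψ := by
    have := contDiff_residual c₀ H
    have h1 : ContDiff ℝ ω fun p : ℝ × ℝ × Wiener => coord 1 (residual c₀ H p.1 p.2.1 p.2.2) :=
      (coord 1).contDiff.comp this
    have h2 : ContDiff ℝ ω fun p : ℝ × ℝ × Wiener => G (residual c₀ H p.1 p.2.1 p.2.2) :=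
      G.contDiff.comp this
    exact ((contDiff_fst.comp contDiff_snd).add (h1.div_const _)).prodMk h2
  set N : Wiener := (3 * c₀) • mulCLM (cosVec 1) H
      - (1 / 2 : ℝ) • mulCLM (cosVec 1) (mulCLM (cosVec 1) (cosVec 1)) with hN
  have hN1 : coord 1 N = 6 * c₀ * (hZero T κ + 1 / 2 * hTwo T κ - 1 / (8 * c₀)) := by
    simp only [hN, hH, secondProfile, map_sub, map_add, map_smul, mulCLM_cosVec, coord_apply,
      cosVec_apply, smul_eq_mul]
    norm_num
    field_simp
    ring
  have hfix : ∀ y, Ψ (0, y) = (coord 1 N / (4 * c₀), G N) := by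
    intro y
    simp only [hΨ, residual_zero, ← hN, map_add, map_smul, hG1, smul_zero, zero_add]
    congr 1
    simp only [coord_apply, cosVec_apply, smul_eq_mul]
    norm_num
    field_simp
    ring
  obtain ⟨φ, hφ0, hφ, hev⟩ := exists_contDiffAt_fixedPoint hsmooth hfix
  refine ⟨fun a => (φ a).1, fun a => (φ a).2, contDiffAt_fst.comp 0 hφ, contDiffAt_snd.comp 0 hφ,
    ?_, ?_⟩
  · simp only [hφ0, hN1]
    field_simp
    ring
  · filter_upwards [hev] with a ha n
    have h1 := congr_arg Prod.fst ha
    have h2 := congr_arg Prod.snd ha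
    simp only [hΨ] at h1 h2
    -- At `n = 1` both sides vanish, the right one by the first fixed-point equation.
    by_cases hn : n = 1
    · rw [add_eq_left, div_eq_zero_iff, or_iff_left (by positivity), coord_apply] at h1
      rw [hn, h1, Nat.cast_one, mul_one, ← hc₀, sub_self, zero_mul]
    · conv_lhs => rw [← h2, hGn]
      rw [mul_inv_cancel_left₀ (hres n hn)]

theorem eval_residual (c₀ : ℝ) (H : Wiener) (a l : ℝ) (r : Wiener) (z : ℝ) :
    eval z (residual c₀ H a l r) =
      -(2 * c₀ * l + a ^ 2 * l ^ 2) * (Real.cos z + a * eval z H + a ^ 2 * eval z r)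
      + (3 / 2 * c₀) * (2 * (Real.cos z * (eval z H + a * eval z r))
        + a * (eval z H + a * eval z r) ^ 2)
      + (3 / 2 * a * l) * (Real.cos z + a * eval z H + a ^ 2 * eval z r) ^ 2
      - 1 / 2 * (Real.cos z + a * eval z H + a ^ 2 * eval z r) ^ 3 := by
  simp only [residual, map_sub, map_add, map_smul, add_apply, smul_apply, eval_mulCLM, smul_eq_mul,
    eval_cosVec, Nat.cast_one, one_mul]
  ring

/-- The equation at order `a²`. Since `cos² z = (1 + cos 2z)/2`, only frequencies `0` and `2` occur,
and they fix `h₀` and `h₂`. -/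
theorem linear_secondProfile {T κ : ℝ}
    (hres : ∀ n : ℕ, n ≠ 1 → cww T κ ^ 2 - cww T (κ * n) ^ 2 ≠ 0) (n : ℕ) :
    (cww T κ ^ 2 - cww T (κ * n) ^ 2) * secondProfile T κ n
      = 3 / 2 * cww T κ * mulCLM (cosVec 1) (cosVec 1) n := by
  rw [mulCLM_cosVec, ← coord_apply, ← coord_apply]
  simp only [secondProfile, map_add, map_smul, smul_eq_mul, coord_apply, cosVec_apply]
  have h0 : cww T 0 = 1 := by simp [cww]
  rcases eq_or_ne n 0 with rfl | hn0
  · have := hres 0 (by norm_num)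
    simp only [Nat.cast_zero, mul_zero, h0, one_pow] at this ⊢
    rw [hZero]
    norm_num
    field_simp
    norm_num
  · rcases eq_or_ne n 2 with rfl | hn2
    · have := hres 2 (by norm_num)
      simp only [Nat.cast_ofNat, mul_comm κ 2] at this ⊢
      rw [hTwo]
      norm_num
      field_simp
    · simp [hn0, hn2]

/-! ### The traveling wave and its expansion -/

/-- The encoded wave `u = a cos z + a² H + a³ r`. -/
def wave (H : Wiener) (a : ℝ) (r : Wiener) : Wiener := a • cosVec 1 + a ^ 2 • H + a ^ 3 • r

theorem eval_wave (H : Wiener) (a : ℝ) (r : Wiener) (z : ℝ) :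
    eval z (wave H a r) = a * Real.cos z + a ^ 2 * eval z H + a ^ 3 * eval z r := by
  simp [wave, eval_cosVec]

/-- The elevation `η = c u - u² / 2` in terms of the encoded function `u`. -/
def elevation (c : ℝ) (u : Wiener) : Wiener := c • u - (1 / 2 : ℝ) • mulCLM u u

theorem eval_elevation (c : ℝ) (u : Wiener) (z : ℝ) :
    eval z (elevation c u) = c * eval z u - 1 / 2 * eval z u ^ 2 := by
  simp [elevation, eval_mulCLM, sq]

theorem contDiff_eval_apply (f : Wiener) : ContDiff ℝ ∞ fun z => eval z f :=
  contDiff_eval.clm_apply contDiff_const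

theorem isEvenPeriodicTravelingWave {T κ : ℝ}
    (hres : ∀ n : ℕ, n ≠ 1 → cww T κ ^ 2 - cww T (κ * n) ^ 2 ≠ 0) {a l : ℝ} {r : Wiener}
    (hc : 0 < cww T κ + a ^ 2 * l)
    (hr : ∀ n : ℕ, (cww T κ ^ 2 - cww T (κ * n) ^ 2) * r n
        = residual (cww T κ) (secondProfile T κ) a l r n) :
    IsEvenPeriodicTravelingWave T κ (cww T κ + a ^ 2 * l)
      (fun z => eval z (elevation (cww T κ + a ^ 2 * l) (wave (secondProfile T κ) a r)))
      (fun z => eval z (wave (secondProfile T κ) a r)) where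
  speed_pos := hc
  smooth_η := contDiff_eval_apply _
  smooth_u := contDiff_eval_apply _
  even_η z := by simp only [eval_neg]
  even_u z := by simp only [eval_neg]
  periodic_η z := by simp only [eval_add_two_pi]
  periodic_u z := by simp only [eval_add_two_pi]
  eq_mass := by
    set c₀ := cww T κ with hc₀
    set H := secondProfile T κ with hH
    -- The multiplier image is `c₀² u - L u`, with `L u` read off order by order: `0` at order `a`,
    -- then `(3/2) c₀ cos² z`, then the residual.
    refine ⟨fun z => eval z (c₀ ^ 2 • wave H a r
        - (a ^ 2 * (3 / 2 * c₀)) • mulCLM (cosVec 1) (cosVec 1)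
        - a ^ 3 • residual c₀ H a l r), ?_, fun z => ?_⟩
    · refine isFourierMultiplierImage_eval (fun k => cww T (κ * k) ^ 2) _ _ fun n => ?_
      have h1 : (c₀ ^ 2 - cww T (κ * n) ^ 2) * cosVec 1 n = 0 := by
        rw [cosVec_apply]
        split_ifs with hn
        · rw [hn, Nat.cast_one, mul_one, ← hc₀, sub_self, zero_mul]
        · rw [mul_zero]
      have h2 := linear_secondProfile hres n
      have h3 := hr n
      rw [← coord_apply n (wave H a r), ← coord_apply]
      simp only [wave, map_sub, map_add, map_smul, smul_eq_mul, coord_apply]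
      linear_combination a * h1 + a ^ 2 * h2 + a ^ 3 * h3
    · simp only [map_sub, map_smul, eval_residual, eval_elevation, eval_mulCLM, eval_wave,
        eval_cosVec, smul_eq_mul, Nat.cast_one, one_mul]
      ring
  eq_momentum z := by
    rw [eval_elevation]
    ring

theorem eval_secondProfile (T κ z : ℝ) :
    eval z (secondProfile T κ) = hZero T κ + hTwo T κ * Real.cos (2 * z) := by
  simp [secondProfile, eval_cosVec]

/-- The third-order remainder of the elevation, divided by `a³`. -/
def elevationRemainder (c₀ : ℝ) (H : Wiener) (a l : ℝ) (r : Wiener) : Wiener :=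
  c₀ • r + l • (cosVec 1 + a • H + a ^ 2 • r) - mulCLM (cosVec 1) (H + a • r)
    - (a / 2) • mulCLM (H + a • r) (H + a • r)

/-- Both coefficients `-1/4` come from `-(a²/2) cos² z = -(a²/4)(1 + cos 2z)`. -/
theorem eval_elevation_wave_sub (T κ a l : ℝ) (r : Wiener) (z : ℝ) :
    eval z (elevation (cww T κ + a ^ 2 * l) (wave (secondProfile T κ) a r)) -
        (a * cww T κ * Real.cos z +
            a ^ 2 * (cww T κ * hZero T κ - 1 / 4 +
              (cww T κ * hTwo T κ - 1 / 4) * Real.cos (2 * z)))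
      = eval z (a ^ 3 • elevationRemainder (cww T κ) (secondProfile T κ) a l r) := by
  simp only [elevationRemainder, eval_elevation, eval_wave, map_sub, map_add, map_smul,
    add_apply, smul_apply, eval_mulCLM, smul_eq_mul, eval_cosVec, eval_secondProfile, Nat.cast_one, one_mul,
    Real.cos_two_mul]
  ring

theorem eval_wave_sub (T κ a : ℝ) (r : Wiener) (z : ℝ) :
    eval z (wave (secondProfile T κ) a r) -
        (a * Real.cos z + a ^ 2 * (hZero T κ + hTwo T κ * Real.cos (2 * z)))
      = eval z (a ^ 3 • r) := by
  rw [eval_wave, eval_secondProfile, map_smul, smul_eq_mul]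
  ring

theorem exists_abs_iteratedDeriv_eval_cube_le {a₀ B : ℝ} (f : ℝ → Wiener)
    (hf : ∀ a, |a| < a₀ → ‖f a‖ ≤ B) (k : ℕ) :
    ∃ K : ℝ, ∀ a : ℝ, |a| < a₀ → ∀ z : ℝ,
      |iteratedDeriv k (fun x => eval x (a ^ 3 • f a)) z| ≤ K * |a| ^ 3 := by
  obtain ⟨K, hK0, hK⟩ := exists_abs_iteratedDeriv_eval_le k
  refine ⟨K * B, fun a ha z => (hK _ z).trans ?_⟩
  rw [norm_smul, norm_pow, Real.norm_eq_abs]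
  calc K * (|a| ^ 3 * ‖f a‖) ≤ K * (|a| ^ 3 * B) := by gcongr; exact hf a ha
    _ = K * B * |a| ^ 3 := by ring

end Wiener

end

/-! ### Assembly of the family -/

open Filter Topology Wiener in
theorem mainTheorem2 (T κ : ℝ) (hT : 0 ≤ T) (hκ : 0 < κ)
    (hres : ∀ n : ℕ, 2 ≤ n → cww T κ ≠ cww T (n * κ))
    (hone : cww T κ ≠ 1) :
    ∃ (a₀ : ℝ) (η u : ℝ → ℝ → ℝ) (c : ℝ → ℝ), 0 < a₀ ∧
      -- for every small amplitude `a`, a smooth, even, periodic traveling wave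
      (∀ a : ℝ, |a| < a₀ → IsEvenPeriodicTravelingWave T κ (c a) (η a) (u a)) ∧
      -- smooth dependence on the parameter
      ContDiffOn ℝ ∞ (fun p : ℝ × ℝ => η p.1 p.2) (Set.Ioo (-a₀) a₀ ×ˢ Set.univ) ∧
      ContDiffOn ℝ ∞ (fun p : ℝ × ℝ => u p.1 p.2) (Set.Ioo (-a₀) a₀ ×ˢ Set.univ) ∧
      ContDiffOn ℝ ∞ c (Set.Ioo (-a₀) a₀) ∧
      -- expansions, with remainders `O(a³)` uniformly in `z` together with all `z`-derivatives
      (∀ k : ℕ, ∃ C : ℝ, ∀ a : ℝ, |a| < a₀ → ∀ z : ℝ,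
        |iteratedDeriv k (fun x : ℝ => η a x -
          (a * cww T κ * Real.cos x +
            a ^ 2 * (cww T κ * hZero T κ - 1 / 4 +
              (cww T κ * hTwo T κ - 1 / 4) * Real.cos (2 * x)))) z| ≤ C * |a| ^ 3) ∧
      (∀ k : ℕ, ∃ C : ℝ, ∀ a : ℝ, |a| < a₀ → ∀ z : ℝ,
        |iteratedDeriv k (fun x : ℝ => u a x -
          (a * Real.cos x +
            a ^ 2 * (hZero T κ + hTwo T κ * Real.cos (2 * x)))) z| ≤ C * |a| ^ 3) ∧
      (∃ C : ℝ, ∀ a : ℝ, |a| < a₀ →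
        |c a - (cww T κ +
          3 / 2 * a ^ 2 * (hZero T κ + 1 / 2 * hTwo T κ - 1 / (8 * cww T κ)))|
          ≤ C * |a| ^ 3) := by
  have hres' : ∀ n : ℕ, n ≠ 1 → cww T κ ^ 2 - cww T (κ * n) ^ 2 ≠ 0 := by
    intro n hn h
    have h1 : cww T κ = cww T (n * κ) := by
      rw [mul_comm (n : ℝ)]
      exact (pow_left_inj₀ (cww_nonneg _ _) (cww_nonneg _ _) two_ne_zero).1 (sub_eq_zero.1 h)
    rcases Nat.eq_zero_or_pos n with rfl | hn0
    · exact hone (by simpa [cww] using h1)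
    · exact hres n (by omega) h1
  obtain ⟨l, r, hl, hr, hl0, hev⟩ := exists_branch hT hκ hres'
  set c₀ := cww T κ with hc₀
  set H := secondProfile T κ with hH
  have hrem : ContinuousAt (fun a => elevationRemainder c₀ H a (l a) (r a)) 0 := by
    have := hl.continuousAt
    have := hr.continuousAt
    unfold elevationRemainder
    fun_prop
  have hspeed : ContinuousAt (fun a => c₀ + a ^ 2 * l a) 0 := by
    have := hl.continuousAt
    fun_prop
  have hcpos : ∀ᶠ a in 𝓝 (0 : ℝ), 0 < c₀ + a ^ 2 * l a :=
    hspeed.eventually_const_lt (by simpa using cww_pos hT hκ)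
  have hω : (ω : WithTop ℕ∞) ≠ 0 := by simp
  -- Differentiability gives `l a - l 0 = O(a)`, hence an `O(a³)` error in the speed.
  obtain ⟨K, hK⟩ := ((hl.differentiableAt hω).isBigO_sub).bound
  -- Analyticity at a point persists on a neighbourhood. `ContDiffAt` of order `∞` would only give,
  -- for each finite order, a neighbourhood depending on that order.
  have hsmooth : ∀ᶠ a in 𝓝 (0 : ℝ), ContDiffAt ℝ ω l a ∧ ContDiffAt ℝ ω r a :=
    (hl.eventually (by simp)).and (hr.eventually (by simp))
  have hremlt := hrem.norm.eventually_lt_const (lt_add_one _)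
  have hrlt := hr.continuousAt.norm.eventually_lt_const (lt_add_one _)
  obtain ⟨a₀, ha₀, hall⟩ := Metric.eventually_nhds_iff.1
    (hev.and (hcpos.and (hK.and (hsmooth.and (hremlt.and hrlt)))))
  replace hall : ∀ a : ℝ, |a| < a₀ → _ := fun a ha =>
    hall (y := a) (by rwa [dist_zero_right, Real.norm_eq_abs])
  have hlon : ContDiffOn ℝ ∞ l (Set.Ioo (-a₀) a₀) := fun a ha =>
    ((hall a (abs_lt.2 ha)).2.2.2.1.1.of_le le_top).contDiffWithinAt
  have hron : ContDiffOn ℝ ∞ r (Set.Ioo (-a₀) a₀) := fun a ha =>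
    ((hall a (abs_lt.2 ha)).2.2.2.1.2.of_le le_top).contDiffWithinAt
  have hcon : ContDiffOn ℝ ∞ (fun a => c₀ + a ^ 2 * l a) (Set.Ioo (-a₀) a₀) :=
    contDiffOn_const.add ((contDiffOn_id.pow 2).mul hlon)
  have huon : ContDiffOn ℝ ∞ (fun a => wave H a (r a)) (Set.Ioo (-a₀) a₀) := by
    unfold wave
    fun_prop
  have hηon : ContDiffOn ℝ ∞ (fun a => elevation (c₀ + a ^ 2 * l a) (wave H a (r a)))
      (Set.Ioo (-a₀) a₀) := by
    unfold elevation
    fun_prop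
  have joint : ∀ f : ℝ → Wiener, ContDiffOn ℝ ∞ f (Set.Ioo (-a₀) a₀) →
      ContDiffOn ℝ ∞ (fun p : ℝ × ℝ => eval p.2 (f p.1)) (Set.Ioo (-a₀) a₀ ×ˢ Set.univ) :=
    fun f hf => (contDiff_eval.comp contDiff_snd).contDiffOn.clm_apply
      (hf.comp contDiffOn_fst fun p hp => hp.1)
  refine ⟨a₀, fun a z => eval z (elevation (c₀ + a ^ 2 * l a) (wave H a (r a))),
    fun a z => eval z (wave H a (r a)), fun a => c₀ + a ^ 2 * l a, ha₀,
    fun a ha => isEvenPeriodicTravelingWave hres' (hall a ha).2.1 (hall a ha).1,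
    joint _ hηon, joint _ huon, hcon, fun k => ?_, fun k => ?_, K, fun a ha => ?_⟩
  · simp only [hH, hc₀, eval_elevation_wave_sub]
    exact exists_abs_iteratedDeriv_eval_cube_le _ (fun a ha => (hall a ha).2.2.2.2.1.le) k
  · simp only [hH, eval_wave_sub]
    exact exists_abs_iteratedDeriv_eval_cube_le _ (fun a ha => (hall a ha).2.2.2.2.2.le) k
  · have h := (hall a ha).2.2.1
    rw [sub_zero, Real.norm_eq_abs, Real.norm_eq_abs, hl0] at h
    calc _ = |a| ^ 2 * |l a - 3 / 2 * (hZero T κ + 1 / 2 * hTwo T κ - 1 / (8 * c₀))| := by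
          rw [← abs_pow, ← abs_mul]
          congr 1
          ring
      _ ≤ |a| ^ 2 * (K * |a|) := by gcongr
      _ = K * |a| ^ 3 := by ring
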